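/- Let $L_{2\pi}$ be the space of complex valued integrable functions of period $2\pi$ with the norm $\|f\|_L=\int_{-\pi}^{\pi}|f(x)|\,dx$. For $f\in L_{2\pi}$ let $\hat f(n)=\frac1{2\pi}\int_{-\pi}^{\pi}f(x)e^{-inx}\,dx$ $(n\in\mathbb Z)$ be its Fourier coefficients, $S_n(f,x)=\sum_{k=-n}^{n}\hat f(k)e^{ikx}$ the partial sums of its Fourier series, and $$E_n(f)_L=\inf_{c_{-n},\dots,c_n\in\mathbb C}\Big\|f-\sum_{k=-n}^{n}c_ke^{ikx}\Big\|_L .$$ A complex sequence $\{c_n\}_{n=0}^{\infty}$ belongs to the class $NBVS$ if there is $\theta_0\in[0,\pi/2)$ such that $c_n\in\{z:|\arg z|\le\theta_0\}$ (a sector that contains $0$) for all $n=1,2,\dots$, and there is a constant $K>0$ such that $$\sum_{n=m}^{2m}|c_n-c_{n+1}|\le K\big(|c_m|+|c_{2m}|\big)\qquad\text{for all } m=1,2,\dots .$$ **Theorem 6.** Let $f\in L_{2\pi}$ be a complex valued function, and let $\{\psi_n\}$ be a decreasing (that is, non-increasing) sequence of real numbers tending to zero with $\psi_n=O(\psi_{2n})$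 as $n\to\infty$. If both $\{\hat f(n)\}_{n=0}^{\infty}\in NBVS$ and $\{\hat f(-n)\}_{n=0}^{\infty}\in NBVS$, then $$\|f-S_n(f)\|_L=O(\psi_n)\quad(n\to\infty)$$ if and only if $$E_n(f)_L=O(\psi_n)\quad(n\to\infty)\qquad\text{and}\qquad \hat f(n)\log|n|=O(\psi_{|n|})\quad(n\in\mathbb Z,\ |n|\to\infty).$$ -/

import Mathlib

open Filter Topology Asymptotics

namespace TrigSeries

/-- The class `NBVS`: `c n` lies in a fixed sector `{z : |arg z| ≤ θ₀}`, `θ₀ ∈ [0, π/2)`, for all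
`n ≥ 1` (`Complex.arg 0 = 0`, so that `0` lies in the sector), and
`∑_{n=m}^{2m} |c n - c (n+1)| ≤ K (|c m| + |c (2m)|)` for all `m ≥ 1`. -/
def NBVS (c : ℕ → ℂ) : Prop :=
  (∃ θ₀ : ℝ, 0 ≤ θ₀ ∧ θ₀ < Real.pi / 2 ∧ ∀ n : ℕ, 1 ≤ n → |(c n).arg| ≤ θ₀) ∧
  ∃ K : ℝ, 0 < K ∧ ∀ m : ℕ, 1 ≤ m →
    ∑ n ∈ Finset.Icc m (2 * m), ‖c n - c (n + 1)‖ ≤ K * (‖c m‖ + ‖c (2 * m)‖)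

/-- The space `L_{2π}` of complex valued integrable functions of period `2π`. -/
def IsIntegrablePeriodic (f : ℝ → ℂ) : Prop :=
  Function.Periodic f (2 * Real.pi) ∧
    IntervalIntegrable f MeasureTheory.volume (-Real.pi) Real.pi

/-- `‖f‖_L = ∫_{-π}^{π} |f(x)| dx`. -/
noncomputable def normL (f : ℝ → ℂ) : ℝ :=
  ∫ x in (-Real.pi)..Real.pi, ‖f x‖

/-- The Fourier coefficients of a `2π`-periodic function (see `fhat_eq` for the formula). -/
noncomputable def fhat (f : ℝ → ℂ) (n : ℤ) : ℂ :=
  fourierCoeffOn (a := -Real.pi) (b := Real.pi) (neg_lt_self Real.pi_pos) f n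

/-- `f̂(n) = (1/2π) ∫_{-π}^{π} f(x) e^{-inx} dx`. -/
theorem fhat_eq (f : ℝ → ℂ) (n : ℤ) :
    fhat f n = (1 / (2 * Real.pi) : ℂ) *
      ∫ x in (-Real.pi)..Real.pi, f x * Complex.exp (-(Complex.I * n * x)) := by
  have hpi : (Real.pi : ℂ) ≠ 0 := by exact_mod_cast Real.pi_ne_zero
  have key : ∀ x : ℝ, fourier (-n) (x : AddCircle (Real.pi - -Real.pi)) • f x
      = f x * Complex.exp (-(Complex.I * n * x)) := by
    intro x
    rw [fourier_coe_apply, smul_eq_mul, mul_comm]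
    congr 2
    push_cast
    field_simp
    ring
  rw [fhat, fourierCoeffOn_eq_integral]
  simp_rw [key]
  rw [Complex.real_smul]
  congr 1
  push_cast
  ring

/-- The trigonometric polynomial `∑_{k=-n}^{n} c_k e^{ikx}` of degree `n`. -/
noncomputable def trigPoly (n : ℕ) (c : ℤ → ℂ) (x : ℝ) : ℂ :=
  ∑ k ∈ Finset.Icc (-(n : ℤ)) n, c k * Complex.exp (Complex.I * k * x)

/-- The `n`th partial sum `S_n(f, x)` of the Fourier series of `f`. -/
noncomputable def partialSum (n : ℕ) (f : ℝ → ℂ) : ℝ → ℂ :=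
  trigPoly n (fhat f)

/-- The best approximation `E_n(f)_L` of `f` by trigonometric polynomials of degree `n` in the
integral metric (an infimum of a nonempty set of nonnegative reals). -/
noncomputable def bestApproxL (n : ℕ) (f : ℝ → ℂ) : ℝ :=
  ⨅ c : ℤ → ℂ, normL (fun x => f x - trigPoly n c x)

end TrigSeries

/-! Sufficiency. For `n ≤ m < 2n` every `S_m` reproduces polynomials of degree `n`, and sums of
Dirichlet kernels from `0` are nonnegative Fejér kernels. Hence the mean of these `S_m f`
approximates `f` within `4 E_n(f)` (`normL_sub_delaValleePoussin_le`), and only the blocks `S_m f -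
S_n f` remain. Summation by parts bounds a block by the variation of the coefficients on `[n, 2n]`,
which `NBVS` controls, times the `O(log n)` norm of blocks of exponentials
(`normL_sum_mul_expI_le`).

Necessity. The bound for `E_n` is immediate. For the coefficients, `g = f - S_n f` is paired with
`e^{-inx} ∑_{k ≤ n} sin(kx)/k`, which is bounded uniformly in `n` and `x`. The coefficients of `g`
at `n - k` vanish and those at `n + k` lie in a sector of half-angle less than `π/2`, so no
cancellation occurs and `∑_{k ≤ n} |f̂(n+k)|/k = O(‖g‖)` (`cos_mul_sum_norm_fhat_div_le`). By `NBVS`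
a single coefficient near index `2n` is dominated by those at `n + k` and `2n + 2k`; averaging with
weights `1/k` produces the logarithm (`norm_mul_log_le`). -/

namespace TrigSeries

/-! ### Exponentials, Fourier coefficients and the integral norm -/

/-- The exponential `e^{ikx}` as used in `trigPoly`. -/
noncomputable def expI (k : ℤ) (x : ℝ) : ℂ := Complex.exp (Complex.I * k * x)

@[fun_prop]
theorem continuous_expI (k : ℤ) : Continuous (expI k) := by
  unfold expI; fun_prop

@[simp]
theorem norm_expI (k : ℤ) (x : ℝ) : ‖expI k x‖ = 1 := by
  have h : Complex.I * k * x = ((k * x : ℝ) : ℂ) * Complex.I := by push_cast; ring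
  rw [expI, h, Complex.norm_exp_ofReal_mul_I]

theorem expI_add (j k : ℤ) (x : ℝ) : expI (j + k) x = expI j x * expI k x := by
  simp only [expI, ← Complex.exp_add]
  congr 1; push_cast; ring

@[simp]
theorem expI_zero (x : ℝ) : expI 0 x = 1 := by simp [expI]

theorem expI_sub_right (k : ℤ) (x y : ℝ) : expI k (x - y) = expI k x * expI (-k) y := by
  simp only [expI, ← Complex.exp_add]
  congr 1; push_cast; ring

theorem expI_neg_right (k : ℤ) (x : ℝ) : expI k (-x) = expI (-k) x := by
  simp only [expI]
  congr 1; push_cast; ring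

theorem conj_expI (k : ℤ) (x : ℝ) : (starRingEnd ℂ) (expI k x) = expI (-k) x := by
  simp only [expI, ← Complex.exp_conj]
  congr 1; simp

theorem integral_expI (k : ℤ) :
    ∫ x in (-Real.pi)..Real.pi, expI k x = if k = 0 then (2 * Real.pi : ℂ) else 0 := by
  split_ifs with h
  · subst h
    simp only [expI_zero, intervalIntegral.integral_const]
    simp; ring
  · have hk : Complex.I * k ≠ 0 := by simp [h]
    simp only [expI]
    rw [integral_exp_mul_complex hk, div_eq_zero_iff]
    left
    rw [sub_eq_zero, Complex.exp_eq_exp_iff_exists_int]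
    exact ⟨k, by push_cast; ring⟩

theorem trigPoly_eq (n : ℕ) (c : ℤ → ℂ) (x : ℝ) :
    trigPoly n c x = ∑ k ∈ Finset.Icc (-(n : ℤ)) n, c k * expI k x := rfl

@[fun_prop]
theorem continuous_trigPoly (n : ℕ) (c : ℤ → ℂ) : Continuous (trigPoly n c) := by
  unfold trigPoly; fun_prop

theorem fhat_eq_expI (f : ℝ → ℂ) (n : ℤ) :
    fhat f n = (1 / (2 * Real.pi) : ℂ) *
      ∫ x in (-Real.pi)..Real.pi, f x * expI (-n) x := by
  rw [fhat_eq]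
  congr 2
  ext x
  simp [expI]

/-- Integrability over one period. -/
abbrev IntegrablePeriod (f : ℝ → ℂ) : Prop :=
  IntervalIntegrable f MeasureTheory.volume (-Real.pi) Real.pi

theorem IntegrablePeriod.mul_continuous {f g : ℝ → ℂ} (hf : IntegrablePeriod f)
    (hg : Continuous g) : IntegrablePeriod (fun x => f x * g x) :=
  hf.mul_continuousOn hg.continuousOn

theorem integral_mul_expI (f : ℝ → ℂ) (n : ℤ) :
    ∫ x in (-Real.pi)..Real.pi, f x * expI n x = 2 * Real.pi * fhat f (-n) := by
  have hpi : (Real.pi : ℂ) ≠ 0 := by exact_mod_cast Real.pi_ne_zero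
  rw [fhat_eq_expI, neg_neg]
  field_simp

theorem fhat_sub {f g : ℝ → ℂ} (hf : IntegrablePeriod f) (hg : IntegrablePeriod g) (n : ℤ) :
    fhat (fun x => f x - g x) n = fhat f n - fhat g n := by
  simp only [fhat_eq_expI, sub_mul]
  rw [intervalIntegral.integral_sub (hf.mul_continuous (continuous_expI _))
    (hg.mul_continuous (continuous_expI _))]
  ring

theorem fhat_trigPoly (n : ℕ) (c : ℤ → ℂ) (k : ℤ) :
    fhat (trigPoly n c) k = if k ∈ Finset.Icc (-(n : ℤ)) n then c k else 0 := by
  have hpi : (Real.pi : ℂ) ≠ 0 := by exact_mod_cast Real.pi_ne_zero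
  rw [fhat_eq_expI]
  simp only [trigPoly_eq, Finset.sum_mul, mul_assoc, ← expI_add]
  rw [intervalIntegral.integral_finsetSum
    (fun i _ => (Continuous.intervalIntegrable (by fun_prop) _ _))]
  simp only [intervalIntegral.integral_const_mul, integral_expI, ← sub_eq_add_neg, sub_eq_zero,
    mul_ite, mul_zero]
  rw [Finset.sum_ite_eq']
  split_ifs
  · field_simp
  · simp

theorem fhat_comp_neg (f : ℝ → ℂ) (n : ℤ) : fhat (fun x => f (-x)) n = fhat f (-n) := by
  rw [fhat_eq_expI, fhat_eq_expI]
  congr 1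
  rw [← neg_neg Real.pi, ← intervalIntegral.integral_comp_neg]
  simp [expI_neg_right]

theorem trigPoly_neg (n : ℕ) (c : ℤ → ℂ) (x : ℝ) :
    trigPoly n c (-x) = trigPoly n (fun k => c (-k)) x := by
  rw [trigPoly_eq, trigPoly_eq]
  refine Finset.sum_nbij' (fun k => -k) (fun k => -k) ?_ ?_ ?_ ?_ ?_
  · intro k; simp only [Finset.mem_Icc]; omega
  · intro k; simp only [Finset.mem_Icc]; omega
  · simp
  · simp
  · simp [expI_neg_right]

theorem partialSum_comp_neg (n : ℕ) (f : ℝ → ℂ) (x : ℝ) :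
    partialSum n (fun x => f (-x)) x = partialSum n f (-x) := by
  simp only [partialSum, trigPoly_neg]
  congr 1
  ext k
  exact fhat_comp_neg f k

theorem normL_comp_neg (f : ℝ → ℂ) : normL (fun x => f (-x)) = normL f := by
  simp only [normL]
  rw [intervalIntegral.integral_comp_neg (fun x => ‖f x‖), neg_neg]

theorem neg_pi_le_pi : -Real.pi ≤ Real.pi := by linarith [Real.pi_pos]

theorem normL_nonneg (f : ℝ → ℂ) : 0 ≤ normL f :=
  intervalIntegral.integral_nonneg neg_pi_le_pi fun _ _ => norm_nonneg _

theorem normL_add_le {f g : ℝ → ℂ} (hf : IntegrablePeriod f) (hg : IntegrablePeriod g) :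
    normL (fun x => f x + g x) ≤ normL f + normL g := by
  simp only [normL]
  rw [← intervalIntegral.integral_add hf.norm hg.norm]
  exact intervalIntegral.integral_mono_on neg_pi_le_pi (hf.add hg).norm (hf.norm.add hg.norm)
    fun _ _ => norm_add_le _ _

theorem normL_const_mul (a : ℂ) (f : ℝ → ℂ) : normL (fun x => a * f x) = ‖a‖ * normL f := by
  simp [normL]

theorem normL_sum_le {ι : Type*} (s : Finset ι) (F : ι → ℝ → ℂ)
    (hF : ∀ i ∈ s, IntegrablePeriod (F i)) :
    normL (fun x => ∑ i ∈ s, F i x) ≤ ∑ i ∈ s, normL (F i) := by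
  simp only [normL]
  rw [← intervalIntegral.integral_finsetSum fun i hi => (hF i hi).norm]
  refine intervalIntegral.integral_mono_on neg_pi_le_pi ?_ ?_ fun _ _ => norm_sum_le _ _
  · have := (IntervalIntegrable.sum s hF).norm
    simpa [Finset.sum_fn] using this
  · have := IntervalIntegrable.sum s fun i hi => (hF i hi).norm
    simpa [Finset.sum_fn] using this


/-! ### Blocks of exponentials and summation by parts -/

/-- The block `∑_{n < k ≤ j} e^{ikx}` of exponentials. -/
noncomputable def expBlock (n j : ℕ) (x : ℝ) : ℂ := ∑ k ∈ Finset.Ioc n j, expI k x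

@[fun_prop]
theorem continuous_expBlock (n j : ℕ) : Continuous (expBlock n j) := by
  unfold expBlock; fun_prop

theorem expBlock_succ {n j : ℕ} (h : n ≤ j) (x : ℝ) :
    expBlock n (j + 1) x = expBlock n j x + expI (j + 1 : ℕ) x := by
  rw [expBlock, Finset.sum_Ioc_succ_top (by omega), expBlock]

theorem norm_expBlock_le_card (n j : ℕ) (x : ℝ) : ‖expBlock n j x‖ ≤ (j - n : ℕ) := by
  refine (norm_sum_le _ _).trans ?_
  simp

theorem expBlock_mul {n j : ℕ} (h : n ≤ j) (x : ℝ) :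
    (expI 1 x - 1) * expBlock n j x = expI (j + 1) x - expI (n + 1) x := by
  induction j, h using Nat.le_induction with
  | base => simp [expBlock]
  | succ j hj ih =>
    rw [expBlock_succ hj, mul_add, ih, sub_mul, ← expI_add]
    push_cast
    rw [add_comm (1 : ℤ) (j + 1)]
    ring

/-- Jordan's inequality applied to `|e^{ix} - 1| = 2 |sin (x/2)|`. -/
theorem abs_le_norm_expI_one_sub_one {x : ℝ} (hx : |x| ≤ Real.pi) :
    2 * |x| / Real.pi ≤ ‖expI 1 x - 1‖ := by
  have h : expI 1 x = Complex.exp (Complex.I * x) := by simp [expI]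
  have h2 : |x / 2| = |x| / 2 := by rw [abs_div, abs_two]
  have h3 := Real.mul_le_sin (x := |x / 2|) (abs_nonneg _) (by linarith)
  rw [h, Complex.norm_exp_I_mul_ofReal_sub_one, norm_mul, Real.norm_eq_abs, Real.norm_eq_abs,
    abs_two, Real.abs_sin_eq_sin_abs_of_abs_le_pi (by linarith [abs_nonneg x])]
  refine le_trans (le_of_eq ?_) (mul_le_mul_of_nonneg_left h3 zero_le_two)
  rw [h2]; ring

theorem norm_expBlock_le_div (n j : ℕ) {x : ℝ} (hx0 : x ≠ 0) (hx : |x| ≤ Real.pi) :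
    ‖expBlock n j x‖ ≤ Real.pi / |x| := by
  have hpos : 0 < |x| := abs_pos.2 hx0
  rcases le_total j n with h | h
  · have : expBlock n j x = 0 := by rw [expBlock, Finset.Ioc_eq_empty (by omega), Finset.sum_empty]
    rw [this, norm_zero]; positivity
  have h1 := congrArg norm (expBlock_mul h x)
  rw [norm_mul] at h1
  have h2 : ‖expI (j + 1) x - expI (n + 1) x‖ ≤ 2 := by
    refine (norm_sub_le _ _).trans ?_
    simp; norm_num
  have h3 := mul_le_mul_of_nonneg_right (abs_le_norm_expI_one_sub_one hx)
    (norm_nonneg (expBlock n j x))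
  rw [h1] at h3
  have h4 := h3.trans h2
  rw [le_div_iff₀ hpos]
  rw [div_mul_eq_mul_div, div_le_iff₀ Real.pi_pos] at h4
  linarith

theorem integral_norm_expBlock_le (n j : ℕ) {a : ℝ} (ha : 0 < a) (ha' : a ≤ Real.pi) :
    ∫ x in a..Real.pi, ‖expBlock n j x‖ ≤ Real.pi * Real.log (Real.pi / a) := by
  have hne : ∀ x ∈ Set.uIcc a Real.pi, x ≠ 0 := fun x hx => by
    rw [Set.uIcc_of_le ha'] at hx; linarith [hx.1]
  have hint : IntervalIntegrable (fun x : ℝ => Real.pi * x⁻¹) MeasureTheory.volume a Real.pi :=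
    (ContinuousOn.mul continuousOn_const (continuousOn_inv₀.mono hne)).intervalIntegrable
  rw [← integral_inv_of_pos ha Real.pi_pos, ← intervalIntegral.integral_const_mul]
  refine intervalIntegral.integral_mono_on ha' (Continuous.intervalIntegrable (by fun_prop) _ _)
    hint fun x hx => ?_
  have hx0 : 0 < x := ha.trans_le hx.1
  have := norm_expBlock_le_div n j hx0.ne' (by rw [abs_of_pos hx0]; exact hx.2)
  rwa [abs_of_pos hx0] at this

theorem norm_expBlock_neg (n j : ℕ) (x : ℝ) : ‖expBlock n j (-x)‖ = ‖expBlock n j x‖ := by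
  rw [← Complex.norm_conj, expBlock, expBlock, map_sum]
  simp [conj_expI, expI_neg_right]

/-- The `L`-norm of a block of `N` exponentials grows at most like `log N`. -/
theorem normL_expBlock_le (n j N : ℕ) (hN : 1 ≤ N) (hj : j - n ≤ N) :
    normL (expBlock n j) ≤ 2 + 2 * Real.pi * Real.log (Real.pi * N) := by
  have hN' : (1 : ℝ) ≤ N := by exact_mod_cast hN
  have hN0 : (0 : ℝ) < N := by linarith
  -- At `|x| = 1/N` the bounds `N` and `π/|x|` are comparable; the inner interval then contributes
  -- at most `2`, the outer ones the logarithm.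
  set a : ℝ := 1 / N with ha
  have ha0 : 0 < a := by positivity
  have ha1 : a ≤ Real.pi := by
    have : a ≤ 1 := by rw [ha, div_le_one hN0]; exact hN'
    linarith [Real.pi_gt_three]
  have hi : ∀ u v, IntervalIntegrable (fun x => ‖expBlock n j x‖) MeasureTheory.volume u v :=
    fun u v => Continuous.intervalIntegrable (by fun_prop) _ _
  have h1 := integral_norm_expBlock_le n j ha0 ha1
  have h2 : ∫ x in (-Real.pi)..(-a), ‖expBlock n j x‖ = ∫ x in a..Real.pi, ‖expBlock n j x‖ := by
    rw [← intervalIntegral.integral_comp_neg]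
    simp only [norm_expBlock_neg]
  have h3 : ∫ x in (-a)..a, ‖expBlock n j x‖ ≤ 2 := by
    calc ∫ x in (-a)..a, ‖expBlock n j x‖ ≤ ∫ x in (-a)..a, (N : ℝ) :=
          intervalIntegral.integral_mono_on (by linarith) (hi _ _) (by simp) fun x _ =>
            (norm_expBlock_le_card n j x).trans (by exact_mod_cast hj)
      _ = 2 := by
          rw [intervalIntegral.integral_const, smul_eq_mul, ha]
          field_simp; norm_num
  have h4 : Real.pi / a = Real.pi * N := by rw [ha]; field_simp
  rw [h4] at h1
  rw [normL, ← intervalIntegral.integral_add_adjacent_intervals (hi _ a) (hi _ _),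
    ← intervalIntegral.integral_add_adjacent_intervals (hi _ (-a)) (hi _ _), h2]
  linarith

/-- Summation by parts. -/
theorem sum_mul_expI_eq (c : ℕ → ℂ) {n m : ℕ} (h : n ≤ m) (x : ℝ) :
    ∑ k ∈ Finset.Ioc n m, c k * expI k x =
      c m * expBlock n m x + ∑ k ∈ Finset.Ico n m, (c k - c (k + 1)) * expBlock n k x := by
  induction m, h using Nat.le_induction with
  | base => simp [expBlock]
  | succ m hm ih =>
    rw [Finset.sum_Ioc_succ_top (by omega), ih, Finset.sum_Ico_succ_top hm, expBlock_succ hm]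
    ring

/-! ### Uniform boundedness of the sine sums -/

theorem sum_sin_div_eq (n : ℕ) (x : ℝ) (M : ℕ) :
    ∑ k ∈ Finset.Ioc M n, Real.sin (k * x) / k =
      (∑ k ∈ Finset.Ioc M n, (1 / k : ℂ) * expI k x).im := by
  rw [Complex.im_sum]
  refine Finset.sum_congr rfl fun k _ => ?_
  have h1 : (1 / k : ℂ) = ((1 / k : ℝ) : ℂ) := by push_cast; rfl
  have h2 : expI k x = Complex.exp ((k * x : ℝ) * Complex.I) := by
    simp only [expI]; congr 1; push_cast; ring
  rw [h1, Complex.im_ofReal_mul, h2, Complex.exp_ofReal_mul_I_im]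
  ring

/-- Summation by parts: the blocks are at most `π/|x|`, and since `1/k` decreases its variation
telescopes to `1/M - 1/n`, cancelling the `1/n` of the end term. -/
theorem abs_sum_sin_div_tail_le {M n : ℕ} (hM : 1 ≤ M) (hn : M ≤ n) {x : ℝ} (hx0 : x ≠ 0)
    (hx : |x| ≤ Real.pi) :
    |∑ k ∈ Finset.Ioc M n, Real.sin (k * x) / k| ≤ Real.pi / |x| * (1 / M) := by
  rw [sum_sin_div_eq]
  refine (Complex.abs_im_le_norm _).trans ?_
  rw [sum_mul_expI_eq (fun k => (1 / k : ℂ)) hn]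
  have hB : ∀ k, ‖expBlock M k x‖ ≤ Real.pi / |x| := fun k => norm_expBlock_le_div M k hx0 hx
  have hdiff : ∀ k ∈ Finset.Ico M n, ‖(1 / (k : ℂ) - 1 / ((k + 1 : ℕ) : ℂ)) * expBlock M k x‖ ≤
      (Real.pi / |x|) * (1 / (k : ℝ) - 1 / ((k + 1 : ℕ) : ℝ)) := fun k hk => by
    have hk0 : (0 : ℝ) < k := by
      have := (Finset.mem_Ico.1 hk).1
      exact_mod_cast (by omega : 0 < k)
    have h1 : (1 / (k : ℂ) - 1 / ((k + 1 : ℕ) : ℂ)) =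
      ((1 / (k : ℝ) - 1 / ((k + 1 : ℕ) : ℝ) : ℝ) : ℂ) := by push_cast; rfl
    have h2 : 0 ≤ 1 / (k : ℝ) - 1 / ((k + 1 : ℕ) : ℝ) := by
      rw [sub_nonneg]
      exact one_div_le_one_div_of_le hk0 (by push_cast; linarith)
    rw [norm_mul, h1, Complex.norm_of_nonneg h2, mul_comm]
    exact mul_le_mul_of_nonneg_right (hB k) h2
  have htel : ∑ k ∈ Finset.Ico M n, (1 / (k : ℝ) - 1 / ((k + 1 : ℕ) : ℝ)) =
      1 / (M : ℝ) - 1 / (n : ℝ) := by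
    have := Finset.sum_Ico_sub (fun k : ℕ => 1 / (k : ℝ)) hn
    rw [← neg_inj, ← Finset.sum_neg_distrib]
    simpa using this
  calc _ ≤ ‖(1 / (n : ℂ)) * expBlock M n x‖ +
        ∑ k ∈ Finset.Ico M n, ‖(1 / (k : ℂ) - 1 / ((k + 1 : ℕ) : ℂ)) * expBlock M k x‖ :=
        (norm_add_le _ _).trans (by gcongr; exact norm_sum_le _ _)
    _ ≤ Real.pi / |x| * (1 / n) +
        ∑ k ∈ Finset.Ico M n, (Real.pi / |x|) * (1 / (k : ℝ) - 1 / ((k + 1 : ℕ) : ℝ)) := by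
        refine add_le_add ?_ (Finset.sum_le_sum hdiff)
        rw [norm_mul, mul_comm]
        have : ‖(1 / (n : ℂ))‖ = 1 / n := by simp
        rw [this]
        exact mul_le_mul_of_nonneg_right (hB n) (by positivity)
    _ = _ := by rw [← Finset.mul_sum, htel]; ring

theorem abs_sum_sin_div_head_le (n : ℕ) (x : ℝ) :
    |∑ k ∈ Finset.Ioc 0 n, Real.sin (k * x) / k| ≤ n * |x| := by
  refine (Finset.abs_sum_le_sum_abs _ _).trans ?_
  refine (Finset.sum_le_card_nsmul _ _ |x| fun k hk => ?_).trans (by simp)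
  have hk0 : (0 : ℝ) < k := by exact_mod_cast (Finset.mem_Ioc.1 hk).1
  rw [abs_div, abs_of_pos hk0, div_le_iff₀ hk0]
  refine Real.abs_sin_le_abs.trans ?_
  rw [abs_mul, abs_of_pos hk0, mul_comm]

/-- The partial sums of the sine series `∑ sin (kx) / k` are uniformly bounded. -/
theorem abs_sum_sin_div_le (n : ℕ) {x : ℝ} (hx : |x| ≤ Real.pi) :
    |∑ k ∈ Finset.Ioc 0 n, Real.sin (k * x) / k| ≤ 1 + 2 * Real.pi := by
  have hpi := Real.pi_pos
  rcases eq_or_ne x 0 with rfl | hx0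
  · simp; positivity
  have hpos : 0 < |x| := abs_pos.2 hx0
  -- The cut at about `1/|x|` makes `M|x|` bounded above, for the head, and at least `1`, for the
  -- tail.
  set M := ⌊1 / |x|⌋₊ + 1 with hM
  have hM1 : (M : ℝ) * |x| ≤ 1 + Real.pi := by
    have := Nat.floor_le (a := 1 / |x|) (by positivity)
    have h2 := mul_le_mul_of_nonneg_right this hpos.le
    rw [div_mul_cancel₀ _ hpos.ne'] at h2
    rw [hM]; push_cast; linarith
  have hM2 : 1 ≤ (M : ℝ) * |x| := by
    have := Nat.lt_floor_add_one (1 / |x|)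
    rw [div_lt_iff₀ hpos] at this
    rw [hM]; push_cast; linarith
  rcases le_total n M with h | h
  · have : (n : ℝ) * |x| ≤ M * |x| := by gcongr
    linarith [abs_sum_sin_div_head_le n x]
  · rw [← Finset.sum_Ioc_consecutive _ (Nat.zero_le M) h]
    have h1 := abs_sum_sin_div_tail_le (Nat.le_add_left 1 _) h hx0 hx
    have h2 : Real.pi / |x| * (1 / M) ≤ Real.pi := by
      rw [div_mul_div_comm, mul_one, div_le_iff₀ (by linarith)]
      rw [mul_comm |x|]
      nlinarith
    have h3 := abs_sum_sin_div_head_le M x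
    refine (abs_add_le _ _).trans ?_
    linarith


/-! ### Fejér kernels and de la Vallée Poussin means -/

theorem partialSum_eq_integral {g : ℝ → ℂ} (hg : IntegrablePeriod g) (m : ℕ) (x : ℝ) :
    partialSum m g x = (1 / (2 * Real.pi) : ℂ) * ∫ y in (-Real.pi)..Real.pi,
      g y * ∑ k ∈ Finset.Icc (-(m : ℤ)) m, expI k (x - y) := by
  simp only [partialSum, trigPoly_eq, fhat_eq_expI, Finset.mul_sum]
  rw [intervalIntegral.integral_finsetSum
    fun i _ => hg.mul_continuous (by fun_prop), Finset.mul_sum]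
  refine Finset.sum_congr rfl fun k _ => ?_
  rw [mul_assoc, ← intervalIntegral.integral_mul_const]
  congr 2
  ext y
  rw [expI_sub_right]
  ring

theorem sum_Icc_neg_succ (m : ℕ) (F : ℤ → ℂ) :
    ∑ k ∈ Finset.Icc (-((m + 1 : ℕ) : ℤ)) ((m + 1 : ℕ) : ℤ), F k =
      (∑ k ∈ Finset.Icc (-(m : ℤ)) m, F k) + F ((m + 1 : ℕ) : ℤ) + F (-((m + 1 : ℕ) : ℤ)) := by
  have : Finset.Icc (-((m + 1 : ℕ) : ℤ)) ((m + 1 : ℕ) : ℤ) =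
      insert (-((m + 1 : ℕ) : ℤ)) (insert ((m + 1 : ℕ) : ℤ) (Finset.Icc (-(m : ℤ)) m)) := by
    ext k
    simp only [Finset.mem_insert, Finset.mem_Icc]
    push_cast
    omega
  rw [this, Finset.sum_insert, Finset.sum_insert]
  · ring
  · simp only [Finset.mem_Icc]; push_cast; omega
  · simp only [Finset.mem_insert, Finset.mem_Icc]; push_cast; omega

theorem sum_Icc_neg_eq (m : ℕ) (F : ℤ → ℂ) :
    ∑ k ∈ Finset.Icc (-(m : ℤ)) m, F k =
      F 0 + ∑ k ∈ Finset.Ioc 0 m, F k + ∑ k ∈ Finset.Ioc 0 m, F (-(k : ℤ)) := by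
  induction m with
  | zero => simp
  | succ m ih =>
    rw [sum_Icc_neg_succ, ih, Finset.sum_Ioc_succ_top (by omega),
      Finset.sum_Ioc_succ_top (by omega)]
    ring

/-- This is the cross term in the expansion of `|A + e^{iNt}|²`, with `A` the sum of the first `N`
exponentials. -/
theorem expI_mul_conj_sum (N : ℕ) (t : ℝ) :
    expI N t * (starRingEnd ℂ) (∑ j ∈ Finset.range N, expI j t) =
      ∑ k ∈ Finset.Ioc 0 N, expI k t := by
  rw [map_sum, Finset.mul_sum]
  simp only [conj_expI, ← expI_add]
  refine Finset.sum_nbij' (fun j => N - j) (fun k => N - k) ?_ ?_ ?_ ?_ ?_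
  · intro j; simp only [Finset.mem_range, Finset.mem_Ioc]; omega
  · intro j; simp only [Finset.mem_range, Finset.mem_Ioc]; omega
  · intro j; simp only [Finset.mem_range]; omega
  · intro j; simp only [Finset.mem_Ioc]; omega
  · intro j hj
    rw [Finset.mem_range] at hj
    rw [Nat.cast_sub hj.le, sub_eq_add_neg]

/-- The sum of the first `N` Dirichlet kernels is the nonnegative Fejér kernel. -/
theorem sum_dirichlet_eq_normSq (N : ℕ) (t : ℝ) :
    ∑ m ∈ Finset.range N, ∑ k ∈ Finset.Icc (-(m : ℤ)) m, expI k t =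
      (Complex.normSq (∑ j ∈ Finset.range N, expI j t) : ℂ) := by
  induction N with
  | zero => simp
  | succ N ih =>
    rw [Finset.sum_range_succ, ih, Finset.sum_range_succ _ N]
    have h1 := expI_mul_conj_sum N t
    have h2 := congrArg (starRingEnd ℂ) h1
    have h3 : expI N t * (starRingEnd ℂ) (expI N t) = 1 := by
      rw [conj_expI, ← expI_add, add_neg_cancel, expI_zero]
    rw [map_mul, Complex.conj_conj, map_sum] at h2
    simp only [conj_expI _ t] at h2
    -- The two conjugate cross terms are the positive and negative halves of the new Dirichlet
    -- kernel, and `|e^{iNt}|² = 1` is its constant term.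
    rw [sum_Icc_neg_eq, expI_zero, ← h1, ← h2, ← Complex.mul_conj, ← Complex.mul_conj, map_add]
    rw [← conj_expI]
    linear_combination (norm := ring_nf) (-1 : ℂ) * h3

theorem sum_partialSum_eq_integral {g : ℝ → ℂ} (hg : IntegrablePeriod g) (N : ℕ) (x : ℝ) :
    ∑ m ∈ Finset.range N, partialSum m g x = (1 / (2 * Real.pi) : ℂ) *
      ∫ y in (-Real.pi)..Real.pi,
        g y * (Complex.normSq (∑ j ∈ Finset.range N, expI j (x - y)) : ℂ) := by
  simp only [← sum_dirichlet_eq_normSq, partialSum_eq_integral hg, ← Finset.mul_sum]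
  rw [← intervalIntegral.integral_finsetSum fun i _ => hg.mul_continuous (by fun_prop)]
  congr 2
  ext y
  rw [Finset.mul_sum]

/-- Positivity of the kernel lets the modulus pass inside the integral. The majorant is a
trigonometric polynomial, so its integral is read off from its zeroth coefficient. -/
theorem norm_sum_partialSum_le {g : ℝ → ℂ} (hg : IntegrablePeriod g) (N : ℕ) (x : ℝ) :
    ‖∑ m ∈ Finset.range N, partialSum m g x‖ ≤
      (∑ m ∈ Finset.range N, partialSum m (fun y => (‖g y‖ : ℂ)) x).re := by
  have hg' : IntegrablePeriod (fun y => (‖g y‖ : ℂ)) :=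
    ⟨hg.norm.1.ofReal, hg.norm.2.ofReal⟩
  have hpi := Real.pi_pos
  have hc : (1 / (2 * Real.pi) : ℂ) = ((1 / (2 * Real.pi) : ℝ) : ℂ) := by push_cast; rfl
  rw [sum_partialSum_eq_integral hg, sum_partialSum_eq_integral hg']
  simp only [← Complex.ofReal_mul]
  rw [intervalIntegral.integral_ofReal, hc, norm_mul, Complex.norm_of_nonneg (by positivity),
    ← Complex.ofReal_mul, Complex.ofReal_re]
  refine mul_le_mul_of_nonneg_left ?_ (by positivity)
  refine (intervalIntegral.norm_integral_le_integral_norm neg_pi_le_pi).trans (le_of_eq ?_)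
  congr 1
  ext y
  rw [norm_mul, Complex.norm_of_nonneg (Complex.normSq_nonneg _)]

theorem integral_partialSum (g : ℝ → ℂ) (m : ℕ) :
    ∫ x in (-Real.pi)..Real.pi, partialSum m g x = 2 * Real.pi * fhat g 0 := by
  simp only [partialSum, trigPoly_eq]
  rw [intervalIntegral.integral_finsetSum fun i _ => Continuous.intervalIntegrable (by fun_prop) _ _]
  simp only [intervalIntegral.integral_const_mul, integral_expI, mul_ite, mul_zero]
  rw [Finset.sum_ite_eq', if_pos (by simp)]
  ring

@[fun_prop]
theorem continuous_partialSum (m : ℕ) (g : ℝ → ℂ) : Continuous (partialSum m g) :=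
  continuous_trigPoly _ _

/-- The sum of the first `N` partial sums is bounded in `L` with constant `N`. -/
theorem normL_sum_partialSum_le {g : ℝ → ℂ} (hg : IntegrablePeriod g) (N : ℕ) :
    normL (fun x => ∑ m ∈ Finset.range N, partialSum m g x) ≤ N * normL g := by
  set h : ℝ → ℂ := fun y => (‖g y‖ : ℂ) with hh
  have hcont : Continuous fun x => ∑ m ∈ Finset.range N, partialSum m h x := by fun_prop
  have key : ∫ x in (-Real.pi)..Real.pi, ∑ m ∈ Finset.range N, partialSum m h x =
      ((N * normL g : ℝ) : ℂ) := by
    rw [intervalIntegral.integral_finsetSum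
      fun i _ => Continuous.intervalIntegrable (by fun_prop) _ _]
    simp only [integral_partialSum]
    have := integral_mul_expI h 0
    simp only [expI_zero, mul_one, neg_zero] at this
    rw [← this, hh, intervalIntegral.integral_ofReal]
    simp [normL]
  have hre : ∫ x in (-Real.pi)..Real.pi, (∑ m ∈ Finset.range N, partialSum m h x).re =
      N * normL g := by
    have := Complex.reCLM.intervalIntegral_comp_comm
      (hcont.intervalIntegrable (μ := MeasureTheory.volume) (-Real.pi) Real.pi)
    rw [key] at this
    simpa only [Complex.reCLM_apply, Complex.ofReal_re] using this
  rw [← hre]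
  refine intervalIntegral.integral_mono_on neg_pi_le_pi
    (Continuous.intervalIntegrable (by fun_prop) _ _)
    ((Complex.continuous_re.comp hcont).intervalIntegrable _ _) fun x _ =>
    norm_sum_partialSum_le hg N x

theorem partialSum_trigPoly {n m : ℕ} (h : n ≤ m) (c : ℤ → ℂ) (x : ℝ) :
    partialSum m (trigPoly n c) x = trigPoly n c x := by
  rw [partialSum, trigPoly_eq, trigPoly_eq]
  simp only [fhat_trigPoly, ite_mul, zero_mul]
  rw [← Finset.sum_filter]
  refine Finset.sum_congr ?_ fun _ _ => rfl
  ext k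
  simp only [Finset.mem_filter, Finset.mem_Icc]
  omega

theorem partialSum_sub {f g : ℝ → ℂ} (hf : IntegrablePeriod f) (hg : IntegrablePeriod g) (m : ℕ)
    (x : ℝ) : partialSum m (fun y => f y - g y) x = partialSum m f x - partialSum m g x := by
  simp only [partialSum, trigPoly_eq, fhat_sub hf hg, sub_mul, Finset.sum_sub_distrib]

theorem normL_sub_le {f g : ℝ → ℂ} (hf : IntegrablePeriod f) (hg : IntegrablePeriod g) :
    normL (fun x => f x - g x) ≤ normL f + normL g := by
  have h := normL_add_le hf hg.neg
  have h2 : normL (-g) = normL g := by simp [normL]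
  rw [h2] at h
  simpa [sub_eq_add_neg] using h

theorem IntegrablePeriod.sub_trigPoly {f : ℝ → ℂ} (hf : IntegrablePeriod f) (n : ℕ)
    (c : ℤ → ℂ) : IntegrablePeriod fun x => f x - trigPoly n c x :=
  hf.sub ((continuous_trigPoly n c).intervalIntegrable _ _)

/-- The de la Vallée Poussin means approximate as well as the best approximation. -/
theorem normL_sub_delaValleePoussin_le {f : ℝ → ℂ} (hf : IntegrablePeriod f) (n : ℕ) (c : ℤ → ℂ) :
    normL (fun x => n * f x - ∑ m ∈ Finset.Ico n (2 * n), partialSum m f x) ≤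
      4 * n * normL (fun x => f x - trigPoly n c x) := by
  set g : ℝ → ℂ := fun x => f x - trigPoly n c x with hg
  have hgi : IntegrablePeriod g := hf.sub_trigPoly n c
  -- Since `m ≥ n`, subtracting the polynomial commutes with `S_m`, so `f` may be replaced by `g`.
  -- The constant is then `n + 2n + n = 4n`.
  have hEq : (fun x => n * f x - ∑ m ∈ Finset.Ico n (2 * n), partialSum m f x) =
      fun x => n * g x - ((∑ m ∈ Finset.range (2 * n), partialSum m g x) -
        ∑ m ∈ Finset.range n, partialSum m g x) := by
    ext x
    rw [← Finset.sum_Ico_eq_sub _ (by omega : n ≤ 2 * n)]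
    have : ∀ m ∈ Finset.Ico n (2 * n), partialSum m g x = partialSum m f x - trigPoly n c x := by
      intro m hm
      rw [← partialSum_trigPoly (Finset.mem_Ico.1 hm).1 c x, hg]
      exact partialSum_sub hf ((continuous_trigPoly n c).intervalIntegrable _ _) m x
    rw [Finset.sum_congr rfl this, Finset.sum_sub_distrib, Finset.sum_const, Nat.card_Ico, hg]
    have h2 : 2 * n - n = n := by omega
    rw [h2, nsmul_eq_mul]
    ring
  have hW : ∀ N, IntegrablePeriod fun x => ∑ m ∈ Finset.range N, partialSum m g x := fun N =>
    Continuous.intervalIntegrable (by fun_prop) _ _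
  have h1 := normL_sub_le (hgi.const_mul (n : ℂ)) ((hW (2 * n)).sub (hW n))
  have h2 := normL_sub_le (hW (2 * n)) (hW n)
  have h3 := normL_sum_partialSum_le hgi (2 * n)
  have h4 := normL_sum_partialSum_le hgi n
  rw [normL_const_mul, Complex.norm_natCast] at h1
  rw [hEq]
  push_cast at h3
  linarith

theorem bestApproxL_le (f : ℝ → ℂ) (n : ℕ) (c : ℤ → ℂ) :
    bestApproxL n f ≤ normL (fun x => f x - trigPoly n c x) :=
  ciInf_le ⟨0, by rintro _ ⟨c, rfl⟩; exact normL_nonneg _⟩ c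

theorem bestApproxL_nonneg (f : ℝ → ℂ) (n : ℕ) : 0 ≤ bestApproxL n f :=
  le_ciInf fun _ => normL_nonneg _

/-- Averaging over `n ≤ m < 2n` splits `f - S_n f` into the error of the de la Vallée Poussin mean
and the mean of `S_m f - S_n f`. -/
theorem normL_sub_partialSum_le {f : ℝ → ℂ} (hf : IntegrablePeriod f) {n : ℕ} (hn : 1 ≤ n) {B : ℝ}
    (hB : ∀ m ∈ Finset.Ico n (2 * n),
      normL (fun x => partialSum m f x - partialSum n f x) ≤ B) :
    normL (fun x => f x - partialSum n f x) ≤ 4 * bestApproxL n f + B := by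
  have hn0 : (0 : ℝ) < n := by exact_mod_cast hn
  have hV : normL (fun x => n * f x - ∑ m ∈ Finset.Ico n (2 * n), partialSum m f x) ≤
      4 * n * bestApproxL n f := by
    rw [← div_le_iff₀' (by positivity)]
    refine le_ciInf fun c => ?_
    rw [div_le_iff₀' (by positivity)]
    exact normL_sub_delaValleePoussin_le hf n c
  have hS : normL (fun x => ∑ m ∈ Finset.Ico n (2 * n), (partialSum m f x - partialSum n f x)) ≤
      n * B := by
    refine (normL_sum_le _ _ fun m _ => Continuous.intervalIntegrable (by fun_prop) _ _).trans ?_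
    refine (Finset.sum_le_card_nsmul _ _ B hB).trans (le_of_eq ?_)
    rw [Nat.card_Ico, nsmul_eq_mul]
    congr 2; omega
  have hEq : (fun x => (n : ℂ) * (f x - partialSum n f x)) = fun x =>
      (n * f x - ∑ m ∈ Finset.Ico n (2 * n), partialSum m f x) +
        ∑ m ∈ Finset.Ico n (2 * n), (partialSum m f x - partialSum n f x) := by
    ext x
    rw [Finset.sum_sub_distrib, Finset.sum_const, Nat.card_Ico, nsmul_eq_mul]
    have h2 : 2 * n - n = n := by omega
    rw [h2]; ring
  have h := normL_add_le (f := fun x => n * f x - ∑ m ∈ Finset.Ico n (2 * n), partialSum m f x)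
    (g := fun x => ∑ m ∈ Finset.Ico n (2 * n), (partialSum m f x - partialSum n f x))
    ((hf.const_mul (n : ℂ)).sub (Continuous.intervalIntegrable (by fun_prop) _ _))
    (Continuous.intervalIntegrable (by fun_prop) _ _)
  rw [← hEq, normL_const_mul, Complex.norm_natCast] at h
  refine le_of_mul_le_mul_left ?_ hn0
  linarith


/-! ### Consequences of the bounded variation condition -/

section NBV

variable {c : ℕ → ℂ} {K : ℝ}

/-- The defining sum includes the difference at `2n`, so it reaches `c (2n+1)`; this extra index
later serves the odd `N`. -/
theorem sum_Ico_norm_sub_le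
    (hK : ∀ m : ℕ, 1 ≤ m →
      ∑ n ∈ Finset.Icc m (2 * m), ‖c n - c (n + 1)‖ ≤ K * (‖c m‖ + ‖c (2 * m)‖))
    {n m : ℕ} (hn : 1 ≤ n) (hm : m ≤ 2 * n + 1) :
    ∑ k ∈ Finset.Ico n m, ‖c k - c (k + 1)‖ ≤ K * (‖c n‖ + ‖c (2 * n)‖) := by
  refine le_trans (Finset.sum_le_sum_of_subset_of_nonneg ?_ fun _ _ _ => norm_nonneg _) (hK n hn)
  intro k
  simp only [Finset.mem_Ico, Finset.mem_Icc]
  omega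

theorem norm_le_of_sum_norm_sub_le
    (hK : ∀ m : ℕ, 1 ≤ m →
      ∑ n ∈ Finset.Icc m (2 * m), ‖c n - c (n + 1)‖ ≤ K * (‖c m‖ + ‖c (2 * m)‖))
    {n m : ℕ} (hn : 1 ≤ n) (hnm : n ≤ m) (hm : m ≤ 2 * n + 1) :
    ‖c m‖ ≤ (1 + K) * (‖c n‖ + ‖c (2 * n)‖) := by
  have h1 := dist_le_Ico_sum_dist c hnm
  simp only [dist_eq_norm] at h1
  have h2 := sum_Ico_norm_sub_le hK hn hm
  have h3 := norm_sub_norm_le (c m) (c n)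
  rw [norm_sub_rev] at h3
  linarith [norm_nonneg (c (2 * n))]

/-- Summation by parts: the end coefficient costs `1 + K`, the variation `K`, and each block has at
most `n` terms. -/
theorem normL_sum_mul_expI_le
    (hK : ∀ m : ℕ, 1 ≤ m →
      ∑ n ∈ Finset.Icc m (2 * m), ‖c n - c (n + 1)‖ ≤ K * (‖c m‖ + ‖c (2 * m)‖))
    {n m : ℕ} (hn : 1 ≤ n) (hnm : n ≤ m) (hm : m ≤ 2 * n) :
    normL (fun x => ∑ k ∈ Finset.Ioc n m, c k * expI k x) ≤
      (1 + 2 * K) * (‖c n‖ + ‖c (2 * n)‖) * (2 + 2 * Real.pi * Real.log (Real.pi * n)) := by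
  set L := 2 + 2 * Real.pi * Real.log (Real.pi * n) with hL
  have hB : ∀ k, k ≤ m → normL (expBlock n k) ≤ L := fun k hk =>
    normL_expBlock_le n k n hn (by omega)
  have hL0 : 0 ≤ L := (normL_nonneg _).trans (hB n hnm)
  have hEq : (fun x => ∑ k ∈ Finset.Ioc n m, c k * expI k x) = fun x =>
      c m * expBlock n m x + ∑ k ∈ Finset.Ico n m, (c k - c (k + 1)) * expBlock n k x := by
    ext x; exact sum_mul_expI_eq c hnm x
  have h1 := normL_add_le (f := fun x => c m * expBlock n m x)
    (g := fun x => ∑ k ∈ Finset.Ico n m, (c k - c (k + 1)) * expBlock n k x)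
    (Continuous.intervalIntegrable (by fun_prop) _ _)
    (Continuous.intervalIntegrable (by fun_prop) _ _)
  have h2 := normL_sum_le (Finset.Ico n m) (fun k x => (c k - c (k + 1)) * expBlock n k x)
    fun k _ => Continuous.intervalIntegrable (by fun_prop) _ _
  simp only [normL_const_mul] at h1 h2
  have h3 : ∑ k ∈ Finset.Ico n m, ‖c k - c (k + 1)‖ * normL (expBlock n k) ≤
      (∑ k ∈ Finset.Ico n m, ‖c k - c (k + 1)‖) * L := by
    rw [Finset.sum_mul]
    refine Finset.sum_le_sum fun k hk => mul_le_mul_of_nonneg_left (hB k ?_) (norm_nonneg _)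
    exact (Finset.mem_Ico.1 hk).2.le
  have h4 := mul_le_mul_of_nonneg_right (sum_Ico_norm_sub_le hK hn (by omega : m ≤ 2 * n + 1)) hL0
  have h5 := mul_le_mul (norm_le_of_sum_norm_sub_le hK hn hnm (by omega)) (hB m le_rfl)
    (normL_nonneg _) ((norm_nonneg _).trans (norm_le_of_sum_norm_sub_le hK hn hnm (by omega)))
  rw [hEq]
  linarith

end NBV

/-- Negative frequencies are written at `-x`, so that reflection invariance of the norm reduces them
to the one-sided estimate. -/
theorem partialSum_sub_partialSum (f : ℝ → ℂ) {n m : ℕ} (h : n ≤ m) (x : ℝ) :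
    partialSum m f x - partialSum n f x =
      ∑ k ∈ Finset.Ioc n m, fhat f k * expI k x +
        ∑ k ∈ Finset.Ioc n m, fhat f (-(k : ℤ)) * expI k (-x) := by
  simp only [partialSum, trigPoly_eq, expI_neg_right]
  rw [sum_Icc_neg_eq m (fun k => fhat f k * expI k x), sum_Icc_neg_eq n,
    ← Finset.sum_Ioc_consecutive _ (Nat.zero_le n) h,
    ← Finset.sum_Ioc_consecutive (fun k : ℕ => fhat f (-(k : ℤ)) * expI (-(k : ℤ)) x)
      (Nat.zero_le n) h]
  ring

theorem one_le_log_natCast {n : ℕ} (hn : 4 ≤ n) : 1 ≤ Real.log n := by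
  have h : (4 : ℝ) ≤ n := by exact_mod_cast hn
  rw [Real.le_log_iff_exp_le (by linarith)]
  linarith [Real.exp_one_lt_d9]

theorem log_pi_mul_le {n : ℕ} (hn : 4 ≤ n) :
    2 + 2 * Real.pi * Real.log (Real.pi * n) ≤ (2 + 4 * Real.pi) * Real.log n := by
  have h : (4 : ℝ) ≤ n := by exact_mod_cast hn
  have hpi := Real.pi_pos
  have h1 := one_le_log_natCast hn
  have h2 : Real.log Real.pi ≤ Real.log n :=
    Real.log_le_log hpi (Real.pi_le_four.trans h)
  rw [Real.log_mul hpi.ne' (by linarith)]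
  nlinarith [mul_le_mul_of_nonneg_left h2 hpi.le]

theorem normL_partialSum_sub_le {f : ℝ → ℂ} {K₁ K₂ : ℝ}
    (h₁ : ∀ m : ℕ, 1 ≤ m →
      ∑ n ∈ Finset.Icc m (2 * m), ‖fhat f n - fhat f (n + 1 : ℕ)‖ ≤
        K₁ * (‖fhat f m‖ + ‖fhat f (2 * m : ℕ)‖))
    (h₂ : ∀ m : ℕ, 1 ≤ m →
      ∑ n ∈ Finset.Icc m (2 * m), ‖fhat f (-(n : ℤ)) - fhat f (-((n + 1 : ℕ) : ℤ))‖ ≤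
        K₂ * (‖fhat f (-(m : ℤ))‖ + ‖fhat f (-((2 * m : ℕ) : ℤ))‖))
    {n m : ℕ} (hn : 1 ≤ n) (hnm : n ≤ m) (hm : m ≤ 2 * n) :
    normL (fun x => partialSum m f x - partialSum n f x) ≤
      ((1 + 2 * K₁) * (‖fhat f n‖ + ‖fhat f (2 * n : ℕ)‖) +
        (1 + 2 * K₂) * (‖fhat f (-(n : ℤ))‖ + ‖fhat f (-((2 * n : ℕ) : ℤ))‖)) *
        (2 + 2 * Real.pi * Real.log (Real.pi * n)) := by
  simp only [partialSum_sub_partialSum f hnm]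
  have e₁ := normL_sum_mul_expI_le (c := fun k : ℕ => fhat f k) h₁ hn hnm hm
  have e₂ := normL_sum_mul_expI_le (c := fun k : ℕ => fhat f (-(k : ℤ))) h₂ hn hnm hm
  have e₃ := normL_add_le (f := fun x => ∑ k ∈ Finset.Ioc n m, fhat f k * expI k x)
    (g := fun x => ∑ k ∈ Finset.Ioc n m, fhat f (-(k : ℤ)) * expI k (-x))
    (Continuous.intervalIntegrable (by fun_prop) _ _)
    (Continuous.intervalIntegrable (by fun_prop) _ _)
  rw [normL_comp_neg (fun x => ∑ k ∈ Finset.Ioc n m, fhat f (-(k : ℤ)) * expI k x)] at e₃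
  linarith

/-! ### Coefficient bounds from the error of the partial sums -/

/-- Pairing with the bounded polynomial `e^{-inx} ∑ sin (kx) / k`. -/
theorem norm_sum_fhat_sub_div_le {g : ℝ → ℂ} (hg : IntegrablePeriod g) (n : ℕ) :
    ‖∑ k ∈ Finset.Ioc 0 n, (1 / k : ℂ) * (fhat g (n + k) - fhat g (n - k))‖ ≤
      (1 + 2 * Real.pi) * normL g := by
  have hpi := Real.pi_pos
  have hpi' : (Real.pi : ℂ) ≠ 0 := by exact_mod_cast Real.pi_ne_zero
  have hsin : ∀ x : ℝ, ∑ k ∈ Finset.Ioc 0 n,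
      (1 / k : ℂ) * (expI (-(n + k)) x - expI (-(n - k)) x) =
      expI (-n) x * (-2 * Complex.I * ((∑ k ∈ Finset.Ioc 0 n, Real.sin (k * x) / k : ℝ) : ℂ)) := by
    intro x
    rw [Complex.ofReal_sum, Finset.mul_sum, Finset.mul_sum]
    refine Finset.sum_congr rfl fun k _ => ?_
    have e1 : (-(n + k) : ℤ) = -n + -k := by ring
    have e2 : (-(n - k) : ℤ) = -n + k := by ring
    have e3 : expI k x = Complex.exp ((k * x : ℂ) * Complex.I) := by
      simp only [expI]; congr 1; push_cast; ring
    have e4 : expI (-k) x = Complex.exp (-(k * x : ℂ) * Complex.I) := by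
      simp only [expI]; congr 1; push_cast; ring
    rw [e1, e2, expI_add, expI_add, e3, e4]
    push_cast
    rw [Complex.sin]
    linear_combination (expI (-n) x * (Complex.exp (-(k * x : ℂ) * Complex.I) -
      Complex.exp ((k * x : ℂ) * Complex.I)) / k) * Complex.I_mul_I
  have hEq : ∑ k ∈ Finset.Ioc 0 n, (1 / k : ℂ) * (fhat g (n + k) - fhat g (n - k)) =
      (1 / (2 * Real.pi) : ℂ) * ∫ x in (-Real.pi)..Real.pi, g x * (expI (-n) x *
        (-2 * Complex.I * ((∑ k ∈ Finset.Ioc 0 n, Real.sin (k * x) / k : ℝ) : ℂ))) := by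
    simp only [← hsin, Finset.mul_sum]
    rw [intervalIntegral.integral_finsetSum fun i _ => hg.mul_continuous (by fun_prop),
      Finset.mul_sum]
    refine Finset.sum_congr rfl fun k _ => ?_
    rw [fhat_eq_expI, fhat_eq_expI, ← mul_sub, ← intervalIntegral.integral_sub
      (hg.mul_continuous (by fun_prop)) (hg.mul_continuous (by fun_prop)), mul_left_comm,
      ← intervalIntegral.integral_const_mul]
    congr 2
    ext x
    ring
  have hbound : ‖∫ x in (-Real.pi)..Real.pi, g x * (expI (-n) x *
        (-2 * Complex.I * ((∑ k ∈ Finset.Ioc 0 n, Real.sin (k * x) / k : ℝ) : ℂ)))‖ ≤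
      2 * (1 + 2 * Real.pi) * normL g := by
    rw [normL, ← intervalIntegral.integral_const_mul]
    refine (intervalIntegral.norm_integral_le_integral_norm neg_pi_le_pi).trans ?_
    refine intervalIntegral.integral_mono_on neg_pi_le_pi
      (hg.mul_continuous (by fun_prop)).norm (hg.norm.const_mul _) fun x hx => ?_
    have := abs_sum_sin_div_le n (abs_le.2 ⟨hx.1, hx.2⟩)
    rw [norm_mul, norm_mul, norm_expI, norm_mul, Complex.norm_real, Real.norm_eq_abs, mul_comm]
    refine mul_le_mul_of_nonneg_right ?_ (norm_nonneg _)
    simp only [norm_mul, norm_neg, Complex.norm_I, Complex.norm_ofNat]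
    linarith
  have hc : ‖(1 / (2 * Real.pi) : ℂ)‖ = 1 / (2 * Real.pi) := by
    simp [abs_of_pos hpi]
  rw [hEq, norm_mul, hc, div_mul_eq_mul_div, one_mul, div_le_iff₀ (by positivity)]
  refine hbound.trans ?_
  have : 0 ≤ (1 + 2 * Real.pi) * normL g := mul_nonneg (by positivity) (normL_nonneg g)
  nlinarith [Real.pi_gt_three]

theorem cos_mul_norm_le_re {z : ℂ} {θ : ℝ} (hθ : θ ≤ Real.pi) (h : |z.arg| ≤ θ) :
    Real.cos θ * ‖z‖ ≤ z.re := by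
  rw [← Complex.norm_mul_cos_arg z, mul_comm, ← Real.cos_abs z.arg]
  exact mul_le_mul_of_nonneg_left (Real.cos_le_cos_of_nonneg_of_le_pi (abs_nonneg _) hθ h)
    (norm_nonneg _)

/-- A Hardy type inequality for the Fourier coefficients beyond `n`. -/
theorem cos_mul_sum_norm_fhat_div_le {f : ℝ → ℂ} (hf : IntegrablePeriod f) {θ : ℝ}
    (hθ : θ ≤ Real.pi) (harg : ∀ k : ℕ, 1 ≤ k → |(fhat f k).arg| ≤ θ) (n : ℕ) :
    Real.cos θ * ∑ k ∈ Finset.Ioc 0 n, 1 / (k : ℝ) * ‖fhat f (n + k : ℕ)‖ ≤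
      (1 + 2 * Real.pi) * normL (fun x => f x - partialSum n f x) := by
  set g : ℝ → ℂ := fun x => f x - partialSum n f x with hg
  have hgi : IntegrablePeriod g := hf.sub_trigPoly n _
  have hcoef : ∀ k : ℤ, fhat g k = if k ∈ Finset.Icc (-(n : ℤ)) n then 0 else fhat f k := by
    intro k
    have := fhat_sub hf ((continuous_partialSum n f).intervalIntegrable
      (μ := MeasureTheory.volume) (-Real.pi) Real.pi) k
    rw [hg, this, partialSum, fhat_trigPoly]
    split_ifs <;> simp
  refine le_trans ?_ (norm_sum_fhat_sub_div_le hgi n)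
  refine le_trans ?_ (Complex.re_le_norm _)
  rw [Complex.re_sum, Finset.mul_sum]
  refine Finset.sum_le_sum fun k hk => ?_
  rw [Finset.mem_Ioc] at hk
  -- For `1 ≤ k ≤ n`, `n + k` lies beyond the degree of `S_n f` while `0 ≤ n - k ≤ n` lies within
  -- it.
  rw [hcoef, hcoef, if_neg (by simp only [Finset.mem_Icc]; omega),
    if_pos (by simp only [Finset.mem_Icc]; omega), sub_zero]
  have h1 : (1 / k : ℂ) = ((1 / k : ℝ) : ℂ) := by push_cast; rfl
  rw [h1, Complex.re_ofReal_mul, mul_left_comm]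
  refine mul_le_mul_of_nonneg_left ?_ (by positivity)
  have := cos_mul_norm_le_re hθ (harg (n + k) (by omega))
  push_cast at this ⊢
  exact this

/-- From `N ≤ (n+1)²` and `log (n+1) ≤ H_n`. -/
theorem log_le_two_mul_sum {n N : ℕ} (hn : 1 ≤ N) (hN : N ≤ 2 * n + 1) :
    Real.log N ≤ 2 * ∑ k ∈ Finset.Ioc 0 n, 1 / (k : ℝ) := by
  have h1 := log_add_one_le_harmonic n
  have h2 : ((harmonic n : ℚ) : ℝ) = ∑ k ∈ Finset.Ioc 0 n, 1 / (k : ℝ) := by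
    rw [harmonic_eq_sum_Icc]
    push_cast
    refine Finset.sum_congr ?_ fun _ _ => by rw [one_div]
    ext; simp only [Finset.mem_Icc, Finset.mem_Ioc]; omega
  rw [← h2]
  have h3 : (N : ℝ) ≤ ((n + 1 : ℕ) : ℝ) ^ 2 := by
    have : N ≤ (n + 1) ^ 2 := by nlinarith
    exact_mod_cast this
  have h4 := Real.log_le_log (by exact_mod_cast hn) h3
  rw [Real.log_pow] at h4
  push_cast at h4 h1 ⊢
  linarith

/-- For every `1 ≤ k ≤ n` one has `n + k ≤ N ≤ 2(n+k) + 1`, so `NBVS` bounds `|c_N|` by the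
coefficients at `n + k` and `2n + 2k`. Summing with weights `1/k` gives two Hardy sums, based at `n`
and at `2n`. -/
theorem norm_mul_log_le {c : ℕ → ℂ} {K : ℝ} (hK0 : 0 ≤ K)
    (hK : ∀ m : ℕ, 1 ≤ m →
      ∑ n ∈ Finset.Icc m (2 * m), ‖c n - c (n + 1)‖ ≤ K * (‖c m‖ + ‖c (2 * m)‖))
    {n N : ℕ} (h1 : 1 ≤ N) (h2 : 2 * n ≤ N) (h3 : N ≤ 2 * n + 1) :
    ‖c N‖ * Real.log N ≤ 2 * (1 + K) * (∑ k ∈ Finset.Ioc 0 n, 1 / (k : ℝ) * ‖c (n + k)‖ +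
      2 * ∑ k ∈ Finset.Ioc 0 (2 * n), 1 / (k : ℝ) * ‖c (2 * n + k)‖) := by
  -- As `1/k = 2/(2k)`, the left side is twice the even-indexed part of the sum on the right.
  have hsum : ∑ k ∈ Finset.Ioc 0 n, 1 / (k : ℝ) * ‖c (2 * n + 2 * k)‖ ≤
      2 * ∑ k ∈ Finset.Ioc 0 (2 * n), 1 / (k : ℝ) * ‖c (2 * n + k)‖ := by
    have hinj : Set.InjOn (fun k : ℕ => 2 * k) (Finset.Ioc 0 n) := fun a _ b _ h => by
      simpa using h
    have hsub : (Finset.Ioc 0 n).image (fun k => 2 * k) ⊆ Finset.Ioc 0 (2 * n) := by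
      intro k
      simp only [Finset.mem_image, Finset.mem_Ioc]
      rintro ⟨j, hj, rfl⟩
      omega
    have := Finset.sum_le_sum_of_subset_of_nonneg
      (f := fun k : ℕ => 1 / (k : ℝ) * ‖c (2 * n + k)‖) hsub fun _ _ _ => by positivity
    rw [Finset.sum_image hinj] at this
    refine le_trans (le_of_eq ?_) (mul_le_mul_of_nonneg_left this zero_le_two)
    rw [Finset.mul_sum]
    refine Finset.sum_congr rfl fun k hk => ?_
    push_cast
    rw [← div_div]
    ring
  calc ‖c N‖ * Real.log N ≤ ‖c N‖ * (2 * ∑ k ∈ Finset.Ioc 0 n, 1 / (k : ℝ)) :=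
        mul_le_mul_of_nonneg_left (log_le_two_mul_sum h1 h3) (norm_nonneg _)
    _ = 2 * ∑ k ∈ Finset.Ioc 0 n, 1 / (k : ℝ) * ‖c N‖ := by
        rw [← Finset.sum_mul]; ring
    _ ≤ 2 * ∑ k ∈ Finset.Ioc 0 n, 1 / (k : ℝ) *
          ((1 + K) * (‖c (n + k)‖ + ‖c (2 * n + 2 * k)‖)) := by
        refine mul_le_mul_of_nonneg_left (Finset.sum_le_sum fun k hk => ?_) zero_le_two
        rw [Finset.mem_Ioc] at hk
        refine mul_le_mul_of_nonneg_left ?_ (by positivity)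
        have := norm_le_of_sum_norm_sub_le hK (n := n + k) (m := N) (by omega) (by omega)
          (by omega)
        rwa [mul_add 2 n k] at this
    _ = 2 * (1 + K) * (∑ k ∈ Finset.Ioc 0 n, 1 / (k : ℝ) * ‖c (n + k)‖ +
          ∑ k ∈ Finset.Ioc 0 n, 1 / (k : ℝ) * ‖c (2 * n + 2 * k)‖) := by
        rw [← Finset.sum_add_distrib, Finset.mul_sum, Finset.mul_sum]
        exact Finset.sum_congr rfl fun k _ => by ring
    _ ≤ _ := by gcongr

/-! ### Passage to order estimates -/

theorem nonneg_of_antitoneOn_of_tendsto {ψ : ℕ → ℝ} (hψ_anti : AntitoneOn ψ (Set.Ici 1))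
    (hψ_lim : Tendsto ψ atTop (𝓝 0)) {n : ℕ} (hn : 1 ≤ n) : 0 ≤ ψ n := by
  refine le_of_tendsto hψ_lim ?_
  filter_upwards [eventually_ge_atTop n] with m hm
  exact hψ_anti hn (hn.trans hm : 1 ≤ m) hm

theorem fhat_mul_log_isBigO {f : ℝ → ℂ} (hf : IntegrablePeriod f)
    {ψ : ℕ → ℝ} (hψ_anti : AntitoneOn ψ (Set.Ici 1)) (hψ_lim : Tendsto ψ atTop (𝓝 0))
    (hψ_dbl : ψ =O[atTop] (fun n : ℕ => ψ (2 * n)))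
    (hc : NBVS (fun n : ℕ => fhat f (n : ℤ)))
    (h : (fun n : ℕ => normL (fun x => f x - partialSum n f x)) =O[atTop] ψ) :
    (fun n : ℕ => fhat f (n : ℤ) * (Real.log n : ℂ)) =O[atTop] ψ := by
  obtain ⟨⟨θ, hθ0, hθ, harg⟩, K, hK0, hK⟩ := hc
  -- The strict inequality `θ < π/2` is what permits division by `cos θ`.
  have hcos : 0 < Real.cos θ := Real.cos_pos_of_mem_Ioo ⟨by linarith [Real.pi_pos], hθ⟩
  have hA : (fun n : ℕ => ∑ k ∈ Finset.Ioc 0 n, 1 / (k : ℝ) * ‖fhat f (n + k : ℕ)‖)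
      =O[atTop] ψ := by
    refine IsBigO.trans (IsBigO.of_bound ((1 + 2 * Real.pi) / Real.cos θ)
      (Eventually.of_forall fun n => ?_)) h
    have := cos_mul_sum_norm_fhat_div_le hf (by linarith [Real.pi_pos]) harg n
    rw [Real.norm_of_nonneg (Finset.sum_nonneg fun _ _ => by positivity),
      Real.norm_of_nonneg (normL_nonneg _), div_mul_eq_mul_div, le_div_iff₀ hcos]
    linarith
  have hhalf : Tendsto (fun N : ℕ => N / 2) atTop atTop :=
    tendsto_atTop.2 fun b => by
      filter_upwards [eventually_ge_atTop (2 * b)] with N hN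
      omega
  have hdouble : Tendsto (fun n : ℕ => 2 * n) atTop atTop :=
    tendsto_atTop.2 fun b => by
      filter_upwards [eventually_ge_atTop b] with N hN
      omega
  have hψ2 : (fun n => ψ (2 * n)) =O[atTop] ψ := by
    refine IsBigO.of_bound 1 ?_
    filter_upwards [eventually_ge_atTop 1] with n hn
    have h2 : 1 ≤ 2 * n := by omega
    rw [Real.norm_of_nonneg (nonneg_of_antitoneOn_of_tendsto hψ_anti hψ_lim hn), one_mul,
      Real.norm_of_nonneg (nonneg_of_antitoneOn_of_tendsto hψ_anti hψ_lim h2)]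
    exact hψ_anti hn h2 (by omega)
  -- Doubling is used twice because `2 (N/2)` may be `N - 1`, whereas `4 (N/2) ≥ N` once `N ≥ 2`.
  have hψ4 : (fun N => ψ (N / 2)) =O[atTop] ψ := by
    refine ((hψ_dbl.trans (hψ_dbl.comp_tendsto hdouble)).comp_tendsto hhalf).trans ?_
    refine IsBigO.of_bound 1 ?_
    filter_upwards [eventually_ge_atTop 2] with N hN
    have h1 : 1 ≤ N := by omega
    have h2 : 1 ≤ 2 * (2 * (N / 2)) := by omega
    simp only [Function.comp_apply]
    rw [Real.norm_of_nonneg (nonneg_of_antitoneOn_of_tendsto hψ_anti hψ_lim h1), one_mul,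
      Real.norm_of_nonneg (nonneg_of_antitoneOn_of_tendsto hψ_anti hψ_lim h2)]
    exact hψ_anti h1 h2 (by omega)
  have hsum := ((hA.add ((hA.comp_tendsto hdouble).trans hψ2 |>.const_mul_left 2)).const_mul_left
    (2 * (1 + K))).comp_tendsto hhalf |>.trans hψ4
  refine IsBigO.trans (IsBigO.of_bound 1 ?_) hsum
  filter_upwards [eventually_ge_atTop 2] with N hN
  have := norm_mul_log_le hK0.le hK (n := N / 2) (N := N) (by omega) (by omega) (by omega)
  rw [norm_mul, Complex.norm_real, Real.norm_of_nonneg (Real.log_natCast_nonneg N), one_mul]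
  exact this.trans (le_abs_self _)

theorem isBigO_cofinite_int_iff {u : ℤ → ℂ} {ψ : ℕ → ℝ} :
    u =O[cofinite] (fun n : ℤ => ψ n.natAbs) ↔
      (fun n : ℕ => u n) =O[atTop] ψ ∧ (fun n : ℕ => u (-(n : ℤ))) =O[atTop] ψ := by
  constructor
  · intro h
    rw [← Nat.cofinite_eq_atTop]
    have hneg : Function.Injective fun n : ℕ => -(n : ℤ) := fun a b hab => by simpa using hab
    have h1 := h.comp_tendsto (Nat.cast_injective (R := ℤ)).tendsto_cofinite
    have h2 := h.comp_tendsto hneg.tendsto_cofinite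
    simpa [Function.comp_def] using And.intro h1 h2
  · rintro ⟨h1, h2⟩
    obtain ⟨C, hC⟩ := h1.bound
    obtain ⟨D, hD⟩ := h2.bound
    obtain ⟨N, hN⟩ := eventually_atTop.1 (hC.and hD)
    refine IsBigO.of_bound (max C D) ?_
    rw [eventually_cofinite]
    refine (Set.finite_Icc (-(N : ℤ)) N).subset fun k hk => ?_
    by_contra hkN
    refine hk ?_
    have hkN' : N ≤ k.natAbs := by
      simp only [Set.mem_Icc] at hkN; omega
    obtain ⟨hp, hm⟩ := hN _ hkN'
    rcases Int.natAbs_eq k with hk' | hk'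
    · rw [← hk'] at hp
      exact hp.trans (mul_le_mul_of_nonneg_right (le_max_left _ _) (norm_nonneg _))
    · rw [← hk'] at hm
      exact hm.trans (mul_le_mul_of_nonneg_right (le_max_right _ _) (norm_nonneg _))

theorem norm_add_norm_mul_log_isBigO {c : ℕ → ℂ} {ψ : ℕ → ℝ}
    (hψ_anti : AntitoneOn ψ (Set.Ici 1)) (hψ_lim : Tendsto ψ atTop (𝓝 0))
    (h : (fun n : ℕ => c n * (Real.log n : ℂ)) =O[atTop] ψ) :
    (fun n : ℕ => (‖c n‖ + ‖c (2 * n)‖) * Real.log n) =O[atTop] ψ := by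
  obtain ⟨C, hC0, hC⟩ := h.exists_nonneg
  obtain ⟨N, hN⟩ := eventually_atTop.1 hC.bound
  refine IsBigO.of_bound (2 * C) ?_
  filter_upwards [eventually_ge_atTop (max N 1)] with n hn
  have hn1 : 1 ≤ n := (le_max_right _ _).trans hn
  have hn2 : 1 ≤ 2 * n := by omega
  have hn0 : (0 : ℝ) < n := by exact_mod_cast hn1
  have a := hN n ((le_max_left _ _).trans hn)
  have b := hN (2 * n) (by have := (le_max_left _ _).trans hn; omega)
  have p1 := nonneg_of_antitoneOn_of_tendsto hψ_anti hψ_lim hn1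
  have p2 := nonneg_of_antitoneOn_of_tendsto hψ_anti hψ_lim hn2
  have hlog := Real.log_natCast_nonneg n
  rw [norm_mul, Complex.norm_real, Real.norm_of_nonneg hlog, Real.norm_of_nonneg p1] at a
  rw [norm_mul, Complex.norm_real, Real.norm_of_nonneg (Real.log_natCast_nonneg _),
    Real.norm_of_nonneg p2] at b
  rw [Real.norm_of_nonneg (by positivity), Real.norm_of_nonneg p1]
  have hmono : ψ (2 * n) ≤ ψ n := hψ_anti hn1 hn2 (by omega)
  have hlog2 : Real.log n ≤ Real.log (2 * n : ℕ) :=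
    Real.log_le_log hn0 (by push_cast; linarith)
  have h3 := mul_le_mul_of_nonneg_left hlog2 (norm_nonneg (c (2 * n)))
  have h4 := mul_le_mul_of_nonneg_left hmono hC0
  linarith

end TrigSeries

/-! ### The equivalence -/

theorem theorem6 (f : ℝ → ℂ) (hf : TrigSeries.IsIntegrablePeriodic f)
    (ψ : ℕ → ℝ) (hψ_anti : AntitoneOn ψ (Set.Ici 1)) (hψ_lim : Tendsto ψ atTop (𝓝 0))
    (hψ_dbl : ψ =O[atTop] (fun n : ℕ => ψ (2 * n)))
    (hpos : TrigSeries.NBVS (fun n : ℕ => TrigSeries.fhat f (n : ℤ)))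
    (hneg : TrigSeries.NBVS (fun n : ℕ => TrigSeries.fhat f (-(n : ℤ)))) :
    (fun n : ℕ => TrigSeries.normL (fun x => f x - TrigSeries.partialSum n f x)) =O[atTop] ψ ↔
      ((fun n : ℕ => TrigSeries.bestApproxL n f) =O[atTop] ψ ∧
        (fun n : ℤ => TrigSeries.fhat f n * (Real.log |(n : ℝ)| : ℂ))
          =O[cofinite] (fun n : ℤ => ψ n.natAbs)) := by
  open TrigSeries in
  have hfi : IntegrablePeriod f := hf.2
  rw [isBigO_cofinite_int_iff]
  simp only [Int.cast_neg, Int.cast_natCast, abs_neg, Nat.abs_cast]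
  constructor
  · intro h
    refine ⟨IsBigO.trans (IsBigO.of_bound 1 (Eventually.of_forall fun n => ?_)) h,
      fhat_mul_log_isBigO hfi hψ_anti hψ_lim hψ_dbl hpos h, ?_⟩
    · rw [Real.norm_of_nonneg (bestApproxL_nonneg f n), Real.norm_of_nonneg (normL_nonneg _),
        one_mul]
      exact bestApproxL_le f n (fhat f)
    -- Reflection `x ↦ -x` exchanges `f̂(n)` and `f̂(-n)` and preserves the error, so the one-sided
    -- result applies again.
    · have hfi' : IntegrablePeriod fun x => f (-x) := by
        have := (IntervalIntegrable.iff_comp_neg (by simp)).1 hfi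
        rw [neg_neg] at this
        exact this.symm
      have hEq : ∀ n, normL (fun x => f (-x) - partialSum n (fun x => f (-x)) x) =
          normL (fun x => f x - partialSum n f x) := fun n => by
        simp only [partialSum_comp_neg]
        exact normL_comp_neg (fun x => f x - partialSum n f x)
      have := fhat_mul_log_isBigO hfi' hψ_anti hψ_lim hψ_dbl (by simpa only [fhat_comp_neg])
        (by simpa only [hEq])
      simpa only [fhat_comp_neg] using this
  · rintro ⟨hE, h₁, h₂⟩
    obtain ⟨-, K₁, hK₁, hv₁⟩ := hpos
    obtain ⟨-, K₂, hK₂, hv₂⟩ := hneg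
    have e₁ := (norm_add_norm_mul_log_isBigO (c := fun n : ℕ => fhat f n) hψ_anti hψ_lim
      h₁).const_mul_left ((2 + 4 * Real.pi) * (1 + 2 * K₁))
    have e₂ := (norm_add_norm_mul_log_isBigO (c := fun n : ℕ => fhat f (-(n : ℤ))) hψ_anti hψ_lim
      h₂).const_mul_left ((2 + 4 * Real.pi) * (1 + 2 * K₂))
    refine IsBigO.trans (IsBigO.of_bound 1 ?_) ((hE.const_mul_left 4).add (e₁.add e₂))
    -- For `n ≥ 4`, `π ≤ n` and `log n ≥ 1`, so the block bound is absorbed into a multiple of `log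
    -- n`.
    filter_upwards [eventually_ge_atTop 4] with n hn
    have key := normL_sub_partialSum_le hfi (by omega : 1 ≤ n) fun m hm =>
      normL_partialSum_sub_le hv₁ hv₂ (by omega) (Finset.mem_Ico.1 hm).1 (Finset.mem_Ico.1 hm).2.le
    rw [Real.norm_of_nonneg (normL_nonneg _), one_mul]
    refine key.trans (le_trans ?_ (le_abs_self _))
    have hmul := mul_le_mul_of_nonneg_left (log_pi_mul_le hn) (show 0 ≤
      (1 + 2 * K₁) * (‖fhat f n‖ + ‖fhat f (2 * n : ℕ)‖) +
        (1 + 2 * K₂) * (‖fhat f (-(n : ℤ))‖ + ‖fhat f (-((2 * n : ℕ) : ℤ))‖) by positivity)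
    linarith
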